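/- Let $\mathbb{F}$ denote the Fano plane, regarded as the $3$-uniform hypergraph with $7$ vertices whose $7$ edges are the lines of the projective plane of order $2$. For a $3$-uniform hypergraph $\mathcal{G}$ on $[n]=\{1,\dots,n\}$ and a set $E\subseteq[n]$, let $d(E)$ be the number of edges of $\mathcal{G}$ containing $E$, and let \[\mathrm{co}_2(\mathcal{G})=\sum_{E\in\binom{[n]}{2}} d(E)^2 .\] Let $\mathrm{exco}_2(n,\mathbb{F})$ be the maximum of $\mathrm{co}_2(\mathcal{G})$ over all $3$-uniform hypergraphs $\mathcal{G}$ on $[n]$ that contain no (not necessarily induced) copy of $\mathbb{F}$. Then the codegree squared density \[\sigma(\mathbb{F})=\lim_{n\to\infty}\frac{\mathrm{exco}_2(n,\mathbb{F})}{\binom{n}{2}(n-2)^2}\] exists and satisfies \[\sigma(\mathbb{F})\le\frac{11}{16}.\] -/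

import Mathlib

namespace CodegreeSquared

/-- The codegree `d(E)` of a vertex set `E`: the number of edges of `G` containing `E`. -/
def codegree {V : Type*} [DecidableEq V] (G : Finset (Finset V)) (E : Finset V) : ℕ :=
  (G.filter fun e => E ⊆ e).card

/-- The codegree squared sum `co₂(G) = ∑ d(E)²` of a `k`-uniform hypergraph `G` on `V`,
the sum being over all `(k-1)`-subsets `E` of `V`. -/
def co2 {V : Type*} [Fintype V] [DecidableEq V] (k : ℕ) (G : Finset (Finset V)) : ℕ :=
  ∑ E ∈ (Finset.univ : Finset V).powersetCard (k - 1), codegree G E ^ 2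

/-- `G` contains a copy of `H`: some injection of the vertices of `H` into the vertices of `G`
sends every edge of `H` to an edge of `G` (the copy need not be induced). -/
def Contains {V W : Type*} (G : Finset (Finset V)) (H : Finset (Finset W)) : Prop :=
  ∃ f : W ↪ V, ∀ e ∈ H, e.map f ∈ G

open Classical in
/-- The `k`-uniform hypergraphs on the vertex set `Fin n` that contain no copy of `H`. -/
noncomputable def freeHypergraphs {W : Type*} (k n : ℕ) (H : Finset (Finset W)) :
    Finset (Finset (Finset (Fin n))) :=
  ((Finset.univ : Finset (Fin n)).powersetCard k).powerset.filter fun G => ¬ Contains G H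

/-- The codegree squared extremal number: the maximum of `co₂(G)` over all `H`-free `k`-uniform
hypergraphs `G` on `n` vertices. -/
noncomputable def exco2 {W : Type*} (k n : ℕ) (H : Finset (Finset W)) : ℕ :=
  (freeHypergraphs k n H).sup (co2 k)

/-- The normalized codegree squared extremal number. -/
noncomputable def scaledExco2 {W : Type*} (k : ℕ) (H : Finset (Finset W)) (n : ℕ) : ℝ :=
  (exco2 k n H : ℝ) / ((n.choose (k - 1) : ℝ) * ((n : ℝ) - (k : ℝ) + 1) ^ 2)

/-- The codegree squared density `σ(H)`: the limit of the normalized codegree squared extremal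
numbers as the number of vertices tends to infinity. -/
noncomputable def sigma {W : Type*} (k : ℕ) (H : Finset (Finset W)) : ℝ :=
  Filter.limUnder Filter.atTop (scaledExco2 k H)

/-- The Fano plane as a 3-uniform hypergraph on 7 points: its lines are the translates of
`{0, 1, 3}` modulo 7. -/
def fano : Finset (Finset (Fin 7)) :=
  {{0, 1, 3}, {1, 2, 4}, {2, 3, 5}, {3, 4, 6}, {4, 5, 0}, {5, 6, 1}, {6, 0, 2}}

end CodegreeSquared

/-! Deleting a vertex and averaging makes the scaled maxima nonincreasing from n = 3 on
(`scaledExco2_succ_le`), so the limit exists. The bound follows from co₂(G) ≤ 11/32 n⁴ + 30 n³ for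
Fano-free G (`exco2_fano_le`), by induction on n with two cases.

If G has no tetrahedron K₄³, counting how many of its four triples a quadruple can span gives co₂(G)
≤ n⁴/3, already below 11/32 n⁴.

If G has a tetrahedron, superpose the links of its four vertices into a multigraph. Four outside
points spanning more than 20 link edges would give three disjoint-matching colours completing a Fano
plane. Hence the multigraph has average multiplicity at most 3 up to lower order terms, and some
tetrahedron vertex has a link of density about 3/4 (`IsTetrahedron.exists_link_le`). Deleting that
vertex costs little (`co2_le_deletion_add`), and the induction hypothesis applies to the rest. -/

open Finset

namespace CodegreeSquared

/-! ### Codegrees as sums of edge indicators over ordered pairs. -/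

section Indicator

variable {V : Type*} [DecidableEq V]

/-- The indicator of `{x, y, z}` being an edge of `G`. -/
noncomputable def edgeInd (G : Finset (Finset V)) (x y z : V) : ℝ :=
  if ({x, y, z} : Finset V) ∈ G then 1 else 0

/-- `G` is a 3-uniform hypergraph. -/
def IsUniform (G : Finset (Finset V)) : Prop := ∀ e ∈ G, e.card = 3

variable {G : Finset (Finset V)}

lemma edgeInd_comm_left (x y z : V) : edgeInd G x y z = edgeInd G y x z := by
  unfold edgeInd
  rw [Finset.insert_comm]

lemma edgeInd_comm_right (x y z : V) : edgeInd G x y z = edgeInd G x z y := by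
  unfold edgeInd
  rw [Finset.pair_comm]

lemma edgeInd_rotate (x y z : V) : edgeInd G x y z = edgeInd G y z x := by
  rw [edgeInd_comm_left, edgeInd_comm_right]

lemma edgeInd_nonneg (x y z : V) : 0 ≤ edgeInd G x y z := by
  unfold edgeInd; split_ifs <;> norm_num

lemma edgeInd_le_one (x y z : V) : edgeInd G x y z ≤ 1 := by
  unfold edgeInd; split_ifs <;> norm_num

lemma edgeInd_sq (x y z : V) : edgeInd G x y z ^ 2 = edgeInd G x y z := by
  unfold edgeInd; split_ifs <;> norm_num

lemma IsUniform.distinct (hG : IsUniform G) {x y z : V} (h : ({x, y, z} : Finset V) ∈ G) :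
    x ≠ y ∧ x ≠ z ∧ y ≠ z := by
  have h3 := hG _ h
  refine ⟨?_, ?_, ?_⟩ <;> rintro rfl
  · have := Finset.card_le_two (a := x) (b := z)
    simp only [Finset.mem_insert, true_or, Finset.insert_eq_of_mem] at h3
    omega
  · have := Finset.card_le_two (a := y) (b := x)
    rw [Finset.insert_comm] at h3
    simp only [Finset.mem_singleton, Finset.insert_eq_of_mem] at h3
    omega
  · have := Finset.card_le_two (a := x) (b := y)
    simp only [Finset.mem_singleton, Finset.insert_eq_of_mem] at h3
    omega

lemma IsUniform.edgeInd_left_self (hG : IsUniform G) (x z : V) : edgeInd G x x z = 0 :=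
  if_neg fun h => (hG.distinct h).1 rfl

lemma IsUniform.edgeInd_right_self (hG : IsUniform G) (x z : V) : edgeInd G z x x = 0 :=
  if_neg fun h => (hG.distinct h).2.2 rfl

lemma IsUniform.edgeInd_outer_self (hG : IsUniform G) (x z : V) : edgeInd G x z x = 0 :=
  if_neg fun h => (hG.distinct h).2.1 rfl

variable [Fintype V]

variable (G) in
/-- The number of `z` such that `{x, y, z}` is an edge of `G`. -/
noncomputable def pairDeg (x y : V) : ℝ :=
  ∑ z, edgeInd G x y z

lemma pairDeg_comm (x y : V) : pairDeg G x y = pairDeg G y x :=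
  Finset.sum_congr rfl fun z _ => edgeInd_comm_left x y z

lemma pairDeg_nonneg (x y : V) : 0 ≤ pairDeg G x y :=
  Finset.sum_nonneg fun z _ => edgeInd_nonneg x y z

lemma pairDeg_le (x y : V) : pairDeg G x y ≤ Fintype.card V := by
  have := Finset.sum_le_sum fun z (_ : z ∈ (univ : Finset V)) => edgeInd_le_one (G := G) x y z
  simpa [pairDeg] using this

lemma IsUniform.pairDeg_self (hG : IsUniform G) (x : V) : pairDeg G x x = 0 :=
  Finset.sum_eq_zero fun z _ => hG.edgeInd_left_self x z

lemma IsUniform.pairDeg_le_sub (hG : IsUniform G) {x y : V} (hxy : x ≠ y) :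
    pairDeg G x y ≤ (Fintype.card V : ℝ) - 2 := by
  have h : ∀ z : V, edgeInd G x y z ≤ 1 - (if z = x then 1 else 0) - (if z = y then 1 else 0) := by
    intro z
    by_cases h1 : z = x
    · subst h1; simp [hG.edgeInd_outer_self, hxy]
    · by_cases h2 : z = y
      · subst h2; simp [hG.edgeInd_right_self, h1]
      · simpa [h1, h2] using edgeInd_le_one x y z
  have := Finset.sum_le_sum fun z (_ : z ∈ (univ : Finset V)) => h z
  simp only [Finset.sum_sub_distrib, Finset.sum_ite_eq', Finset.mem_univ, if_true,
    Finset.sum_const, Finset.card_univ, nsmul_eq_mul, mul_one] at this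
  unfold pairDeg
  linarith

lemma IsUniform.codegree_pair (hG : IsUniform G) {x y : V} (hxy : x ≠ y) :
    (codegree G {x, y} : ℝ) = pairDeg G x y := by
  have : codegree G {x, y} = (univ.filter fun z => ({x, y, z} : Finset V) ∈ G).card := by
    unfold codegree
    symm
    refine Finset.card_bij (fun z _ => {x, y, z}) ?_ ?_ ?_
    · intro z hz
      simp only [Finset.mem_filter, Finset.mem_univ, true_and] at hz ⊢
      refine ⟨hz, ?_⟩
      intro t ht
      simp only [Finset.mem_insert, Finset.mem_singleton] at ht ⊢
      tauto
    · intro z hz z' hz' heq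
      simp only [Finset.mem_filter, Finset.mem_univ, true_and] at hz hz'
      have hd := hG.distinct hz
      have : z ∈ ({x, y, z'} : Finset V) := by rw [← heq]; simp
      simp only [Finset.mem_insert, Finset.mem_singleton] at this
      rcases this with h | h | h
      · exact absurd h.symm hd.2.1
      · exact absurd h.symm hd.2.2
      · exact h
    · intro e he
      simp only [Finset.mem_filter] at he
      obtain ⟨z, hz⟩ : ∃ z, e \ {x, y} = {z} := by
        rw [← Finset.card_eq_one, Finset.card_sdiff_of_subset he.2, hG e he.1,
          Finset.card_pair hxy]
      have he' : ({x, y, z} : Finset V) = e := by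
        have h := Finset.sdiff_union_of_subset he.2
        rw [hz] at h
        rw [← h]
        ext t
        simp only [Finset.mem_insert, Finset.mem_singleton, Finset.mem_union]
        tauto
      exact ⟨z, by simp [he', he.1], he'⟩
  rw [this]
  simp [pairDeg, edgeInd]

/-- Summing a function over ordered pairs of distinct elements counts every 2-subset twice. -/
lemma sum_powersetCard_two (φ : Finset V → ℝ) :
    2 * ∑ E ∈ (univ : Finset V).powersetCard 2, φ E =
      ∑ x, ∑ y, if x = y then 0 else φ {x, y} := by
  have h1 : ∑ p ∈ (univ : Finset V).offDiag, φ {p.1, p.2} =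
      ∑ E ∈ (univ : Finset V).powersetCard 2, 2 * φ E := by
    rw [← Finset.sum_fiberwise_of_maps_to (s := (univ : Finset V).offDiag)
      (t := (univ : Finset V).powersetCard 2) (g := fun p => {p.1, p.2})]
    · refine Finset.sum_congr rfl fun E hE => ?_
      obtain ⟨a, b, hab, rfl⟩ := Finset.card_eq_two.1 (Finset.mem_powersetCard.1 hE).2
      have : (univ : Finset V).offDiag.filter (fun p => ({p.1, p.2} : Finset V) = {a, b}) =
          {(a, b), (b, a)} := by
        ext ⟨x, y⟩
        simp only [Finset.mem_filter, Finset.mem_offDiag, Finset.mem_univ, true_and,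
          Finset.mem_insert, Finset.mem_singleton, Prod.mk.injEq]
        constructor
        · rintro ⟨hne, h⟩
          have hx : x ∈ ({a, b} : Finset V) := by rw [← h]; simp
          have hy : y ∈ ({a, b} : Finset V) := by rw [← h]; simp
          simp only [Finset.mem_insert, Finset.mem_singleton] at hx hy
          grind
        · rintro (⟨rfl, rfl⟩ | ⟨rfl, rfl⟩)
          · exact ⟨hab, rfl⟩
          · exact ⟨hab.symm, Finset.pair_comm _ _⟩
      rw [this, Finset.sum_pair (by simp [hab])]
      simp only
      rw [Finset.pair_comm b a]; ring
    · intro p hp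
      simp only [Finset.mem_offDiag, Finset.mem_univ, true_and] at hp
      simp [Finset.mem_powersetCard, Finset.card_pair hp]
  rw [Finset.mul_sum, ← h1, ← Fintype.sum_prod_type' (f := fun x y => if x = y then 0 else φ {x, y})]
  rw [← Finset.sum_filter_add_sum_filter_not univ (fun p : V × V => p.1 = p.2)]
  rw [Finset.sum_eq_zero (s := univ.filter fun p : V × V => p.1 = p.2)]
  · rw [zero_add]
    refine Finset.sum_congr ?_ ?_
    · ext p; simp
    · intro p hp
      simp only [Finset.mem_filter, Finset.mem_univ, true_and] at hp
      simp [hp]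
  · intro p hp
    simp only [Finset.mem_filter, Finset.mem_univ, true_and] at hp
    simp [hp]

/-- Ordered pairs allow free interchange of sums; the diagonal contributes nothing by uniformity. -/
lemma IsUniform.two_mul_co2 (hG : IsUniform G) :
    2 * (co2 3 G : ℝ) = ∑ x, ∑ y, pairDeg G x y ^ 2 := by
  have := sum_powersetCard_two (V := V) fun E => (codegree G E : ℝ) ^ 2
  unfold co2
  push_cast
  rw [this]
  refine Finset.sum_congr rfl fun x _ => Finset.sum_congr rfl fun y _ => ?_
  split_ifs with h
  · subst h; simp [hG.pairDeg_self]
  · rw [hG.codegree_pair h]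

end Indicator

/-! ### Weighted multigraphs with bounded weight on four vertices. -/

section Multigraph

variable {V : Type*} [DecidableEq V]

lemma sum_sum_sdiff_union {w : V → V → ℝ} (hsymm : ∀ x y, w x y = w y x) {W T : Finset V}
    (hT : T ⊆ W) :
    ∑ x ∈ W, ∑ y ∈ W, w x y =
      (∑ x ∈ W \ T, ∑ y ∈ W \ T, w x y) + 2 * (∑ x ∈ W \ T, ∑ y ∈ T, w x y) +
        ∑ x ∈ T, ∑ y ∈ T, w x y := by
  have h1 : ∀ f : V → ℝ, ∑ x ∈ W, f x = ∑ x ∈ W \ T, f x + ∑ x ∈ T, f x := fun f =>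
    (Finset.sum_sdiff hT).symm
  have h2 : ∑ x ∈ T, ∑ y ∈ W \ T, w x y = ∑ x ∈ W \ T, ∑ y ∈ T, w x y := by
    rw [Finset.sum_comm]
    exact Finset.sum_congr rfl fun x _ => Finset.sum_congr rfl fun y _ => hsymm _ _
  simp_rw [h1, Finset.sum_add_distrib]
  rw [h2]; ring

/-- A multigraph with edge multiplicities at most `4` in which any four vertices span at most
`20` edges has average multiplicity at most `3`. -/
lemma sum_weight_le_of_four_le_twenty {w : V → V → ℝ} (hsymm : ∀ x y, w x y = w y x)
    (hself : ∀ x, w x x = 0) (hle : ∀ x y, w x y ≤ 4)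
    (hint : ∀ x y, ∃ k : ℤ, w x y = k) (W : Finset V)
    (h20 : ∀ x ∈ W, ∀ y ∈ W, ∀ z ∈ W, ∀ t ∈ W, x ≠ y → x ≠ z → x ≠ t → y ≠ z → y ≠ t → z ≠ t →
      w x y + w z t + (w x z + w y t) + (w x t + w y z) ≤ 20) :
    ∑ x ∈ W, ∑ y ∈ W, w x y ≤ 3 * (W.card : ℝ) ^ 2 := by
  induction W using Finset.strongInduction with
  | H W ih =>
  have ih' : ∀ T ⊆ W, T.Nonempty →
      ∑ x ∈ W \ T, ∑ y ∈ W \ T, w x y ≤ 3 * ((W \ T).card : ℝ) ^ 2 := by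
    intro T hT hne
    refine ih _ (Finset.sdiff_ssubset hT hne) ?_
    intro x hx y hy z hz t ht
    exact h20 x (Finset.mem_sdiff.1 hx).1 y (Finset.mem_sdiff.1 hy).1 z (Finset.mem_sdiff.1 hz).1
      t (Finset.mem_sdiff.1 ht).1
  -- Remove a set T of m vertices with internal ordered sum at most 3m² to which every other vertex
  -- sends weight at most 3m. A triangle of weight at least 11 works: outside vertices send at most
  -- 20 - 11 = 9, and 24 ≤ 27.
  by_cases htri : ∃ x ∈ W, ∃ y ∈ W, ∃ z ∈ W, x ≠ y ∧ x ≠ z ∧ y ≠ z ∧ 11 ≤ w x y + w x z + w y z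
  · obtain ⟨x, hx, y, hy, z, hz, hxy, hxz, hyz, h11⟩ := htri
    have hT : ({x, y, z} : Finset V) ⊆ W := by
      intro t ht
      simp only [Finset.mem_insert, Finset.mem_singleton] at ht
      rcases ht with rfl | rfl | rfl <;> assumption
    have hsum : ∀ f : V → ℝ, ∑ t ∈ ({x, y, z} : Finset V), f t = f x + f y + f z := by
      intro f
      rw [Finset.sum_insert (by simp [hxy, hxz]), Finset.sum_pair hyz]; ring
    have hcard : ((W \ {x, y, z}).card : ℝ) + 3 = W.card := by
      have := Finset.card_sdiff_add_card_eq_card hT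
      rw [Finset.card_eq_three.2 ⟨x, y, z, hxy, hxz, hyz, rfl⟩] at this
      exact_mod_cast this
    have hcross : ∑ t ∈ W \ {x, y, z}, ∑ s ∈ ({x, y, z} : Finset V), w t s ≤
        ((W \ {x, y, z}).card : ℝ) * 9 := by
      rw [← nsmul_eq_mul]
      refine Finset.sum_le_card_nsmul _ _ _ fun t ht => ?_
      simp only [Finset.mem_sdiff, Finset.mem_insert, Finset.mem_singleton, not_or] at ht
      have := h20 x hx y hy z hz t ht.1 hxy hxz (Ne.symm ht.2.1) hyz (Ne.symm ht.2.2.1)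
        (Ne.symm ht.2.2.2)
      rw [hsum]
      linarith [hsymm t x, hsymm t y, hsymm t z]
    have h0 := ih' _ hT ⟨x, by simp⟩
    rw [sum_sum_sdiff_union hsymm hT]
    have hin : ∑ t ∈ ({x, y, z} : Finset V), ∑ s ∈ ({x, y, z} : Finset V), w t s ≤ 24 := by
      simp_rw [hsum, hself]
      linarith [hle x y, hle y x, hle x z, hle z x, hle y z, hle z y]
    rw [← hcard]
    nlinarith
  · push Not at htri
    -- Without heavy triangles, a pair of weight 4 works: a third vertex sends less than 7, hence at
    -- most 6 by integrality, and 8 ≤ 12. With no such pair, all weights are at most 3.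
    by_cases hpair : ∃ x ∈ W, ∃ y ∈ W, x ≠ y ∧ w x y = 4
    · obtain ⟨x, hx, y, hy, hxy, h4⟩ := hpair
      have hT : ({x, y} : Finset V) ⊆ W := by
        intro t ht
        simp only [Finset.mem_insert, Finset.mem_singleton] at ht
        rcases ht with rfl | rfl <;> assumption
      have hsum : ∀ f : V → ℝ, ∑ t ∈ ({x, y} : Finset V), f t = f x + f y := fun f =>
        Finset.sum_pair hxy
      have hcard : ((W \ {x, y}).card : ℝ) + 2 = W.card := by
        have := Finset.card_sdiff_add_card_eq_card hT
        rw [Finset.card_pair hxy] at this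
        exact_mod_cast this
      have hcross : ∑ t ∈ W \ {x, y}, ∑ s ∈ ({x, y} : Finset V), w t s ≤
          ((W \ {x, y}).card : ℝ) * 6 := by
        rw [← nsmul_eq_mul]
        refine Finset.sum_le_card_nsmul _ _ _ fun t ht => ?_
        simp only [Finset.mem_sdiff, Finset.mem_insert, Finset.mem_singleton, not_or] at ht
        have := htri x hx y hy t ht.1 hxy (Ne.symm ht.2.1) (Ne.symm ht.2.2)
        rw [hsum]
        obtain ⟨a, ha⟩ := hint x t
        obtain ⟨b, hb⟩ := hint y t
        rw [hsymm t x, hsymm t y, ha, hb]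
        rw [h4, ha, hb] at this
        have h' : a + b < 7 := by
          have : (a : ℝ) + b < 7 := by linarith
          exact_mod_cast this
        have h'' : a + b ≤ 6 := by omega
        exact_mod_cast h''
      have h0 := ih' _ hT ⟨x, by simp⟩
      rw [sum_sum_sdiff_union hsymm hT]
      have hin : ∑ t ∈ ({x, y} : Finset V), ∑ s ∈ ({x, y} : Finset V), w t s ≤ 8 := by
        simp_rw [hsum, hself]
        linarith [hle x y, hle y x]
      rw [← hcard]
      nlinarith
    · push Not at hpair
      have h3 : ∀ x ∈ W, ∀ y ∈ W, w x y ≤ 3 := by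
        intro x hx y hy
        by_cases hxy : x = y
        · subst hxy; rw [hself]; norm_num
        · have hne := hpair x hx y hy hxy
          have hl := hle x y
          obtain ⟨a, ha⟩ := hint x y
          rw [ha] at hne hl ⊢
          have h1 : a ≤ 4 := by exact_mod_cast hl
          have h2 : a ≠ 4 := by exact_mod_cast hne
          have h' : a ≤ 3 := by omega
          exact_mod_cast h'
      calc ∑ x ∈ W, ∑ y ∈ W, w x y ≤ ∑ x ∈ W, ∑ y ∈ W, (3 : ℝ) :=
            Finset.sum_le_sum fun x hx => Finset.sum_le_sum fun y hy => h3 x hx y hy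
        _ = 3 * (W.card : ℝ) ^ 2 := by simp; ring

end Multigraph

/-! ### Squared degrees of a graph. -/

/-- de Caen's bound on the sum of the squared degrees of a graph with adjacency matrix `A`. -/
lemma sum_sq_degree_le {V : Type*} [Fintype V] {A : V → V → ℝ} (hsymm : ∀ x y, A x y = A y x)
    (h0 : ∀ x y, 0 ≤ A x y) (h1 : ∀ x y, A x y ≤ 1) :
    2 * (Fintype.card V : ℝ) * ∑ x, (∑ y, A x y) ^ 2 ≤
      (∑ x, ∑ y, A x y) ^ 2 + (Fintype.card V : ℝ) ^ 2 * ∑ x, ∑ y, A x y := by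
  set n : ℝ := (Fintype.card V : ℝ)
  set d : V → ℝ := fun x => ∑ y, A x y with hd
  set P : ℝ := ∑ x, d x with hP
  have hd0 : ∀ x, 0 ≤ d x := fun x => Finset.sum_nonneg fun y _ => h0 x y
  have hdn : ∀ x, d x ≤ n := by
    intro x
    have := Finset.sum_le_sum fun y (_ : y ∈ (univ : Finset V)) => h1 x y
    simpa using this
  -- The sum of the degrees of the neighbours of x is at most both P and n · d x; the two bounds are
  -- combined with weights d x and n - d x. Summed over x, the left side becomes n ∑ d².
  have key : ∀ x, n * ∑ y, A x y * d y ≤ d x * P + (n - d x) * (d x * n) := by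
    intro x
    have hT1 : ∑ y, A x y * d y ≤ P :=
      Finset.sum_le_sum fun y _ => mul_le_of_le_one_left (hd0 y) (h1 x y)
    have hT2 : ∑ y, A x y * d y ≤ d x * n := by
      rw [hd, Finset.sum_mul]
      exact Finset.sum_le_sum fun y _ => mul_le_mul_of_nonneg_left (hdn y) (h0 x y)
    have e1 := mul_le_mul_of_nonneg_left hT1 (hd0 x)
    have e2 := mul_le_mul_of_nonneg_left hT2 (sub_nonneg.2 (hdn x))
    linarith
  have hsum := Finset.sum_le_sum fun x (_ : x ∈ (univ : Finset V)) => key x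
  have hT : ∑ x, ∑ y, A x y * d y = ∑ x, d x ^ 2 := by
    rw [Finset.sum_comm]
    refine Finset.sum_congr rfl fun y _ => ?_
    rw [← Finset.sum_mul, sq]
    congr 1
    exact Finset.sum_congr rfl fun x _ => hsymm x y
  rw [← Finset.mul_sum, hT, Finset.sum_add_distrib, ← Finset.sum_mul] at hsum
  have e3 : ∑ x, (n - d x) * (d x * n) = n ^ 2 * P - n * ∑ x, d x ^ 2 := by
    rw [hP, Finset.mul_sum, Finset.mul_sum, ← Finset.sum_sub_distrib]
    exact Finset.sum_congr rfl fun x _ => by ring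
  rw [e3] at hsum
  change 2 * n * ∑ x, d x ^ 2 ≤ P ^ 2 + n ^ 2 * P
  linarith

/-! ### Tetrahedra, their links, and Fano planes. -/

section Tetrahedron

variable {V : Type*} [DecidableEq V] {G : Finset (Finset V)}

/-- The four points `k 0, k 1, k 2, k 3` span a complete 3-uniform hypergraph in `G`. -/
def IsTetrahedron (G : Finset (Finset V)) (k : Fin 4 ↪ V) : Prop :=
  ∀ i j l, i ≠ j → i ≠ l → j ≠ l → ({k i, k j, k l} : Finset V) ∈ G

/-- Fano is one line ijk together with the three perfect matchings of the other four points, one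
joined to each point of the line. -/
lemma contains_fano_of_matchings {i j k x y z t : V} (hnodup : [i, j, t, k, x, y, z].Nodup)
    (h0 : ({i, j, k} : Finset V) ∈ G)
    (h1 : ({i, x, y} : Finset V) ∈ G) (h2 : ({i, z, t} : Finset V) ∈ G)
    (h3 : ({j, x, t} : Finset V) ∈ G) (h4 : ({j, y, z} : Finset V) ∈ G)
    (h5 : ({k, x, z} : Finset V) ∈ G) (h6 : ({k, y, t} : Finset V) ∈ G) :
    Contains G fano := by
  -- This order sends the lines of `fano` to the seven given triples.
  refine ⟨⟨[i, j, t, k, x, y, z].get, List.nodup_iff_injective_get.1 hnodup⟩, ?_⟩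
  intro e he
  simp only [fano, Finset.mem_insert, Finset.mem_singleton] at he
  rcases he with rfl | rfl | rfl | rfl | rfl | rfl | rfl
  · convert h0 using 1; simp [Finset.map_insert]
  · convert h3 using 1; simp [Finset.map_insert]; ext; simp; tauto
  · convert h6 using 1; simp [Finset.map_insert]; ext; simp; tauto
  · convert h5 using 1; simp [Finset.map_insert]
  · convert h1 using 1; simp [Finset.map_insert]; ext; simp; tauto
  · convert h4 using 1; simp [Finset.map_insert]; ext; simp; tauto
  · convert h2 using 1; simp [Finset.map_insert]; ext; simp; tauto

/-- Greedy choice, smallest set first. -/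
lemma exists_distinct_of_card_le {α : Type*} [DecidableEq α] {A B C : Finset α}
    (hA : 1 ≤ A.card) (hB : 2 ≤ B.card) (hC : 3 ≤ C.card) :
    ∃ i ∈ A, ∃ j ∈ B, ∃ k ∈ C, i ≠ j ∧ i ≠ k ∧ j ≠ k := by
  obtain ⟨i, hi⟩ := Finset.card_pos.1 hA
  obtain ⟨j, hj, hji⟩ := Finset.exists_mem_ne hB i
  obtain ⟨k, hk, hk'⟩ := Finset.exists_mem_notMem_of_card_lt_card
    (lt_of_le_of_lt (Finset.card_le_two (a := i) (b := j)) hC)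
  simp only [Finset.mem_insert, Finset.mem_singleton, not_or] at hk'
  exact ⟨i, hi, j, hj, k, hk, hji.symm, Ne.symm hk'.1, Ne.symm hk'.2⟩

/-- Each set has at most 4 elements, so a total of 9 forces, in some order, sizes at least 1, 2, 3.
-/
lemma exists_distinct_representatives {A B C : Finset (Fin 4)}
    (h : 9 ≤ A.card + B.card + C.card) :
    ∃ i ∈ A, ∃ j ∈ B, ∃ k ∈ C, i ≠ j ∧ i ≠ k ∧ j ≠ k := by
  have hA := Finset.card_le_univ A
  have hB := Finset.card_le_univ B
  have hC := Finset.card_le_univ C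
  simp only [Fintype.card_fin] at hA hB hC
  have hcases : (2 ≤ B.card ∧ 3 ≤ C.card) ∨ (2 ≤ C.card ∧ 3 ≤ B.card) ∨
      (2 ≤ A.card ∧ 3 ≤ C.card) ∨ (2 ≤ C.card ∧ 3 ≤ A.card) ∨
      (2 ≤ A.card ∧ 3 ≤ B.card) ∨ (2 ≤ B.card ∧ 3 ≤ A.card) := by omega
  rcases hcases with ⟨h2, h3⟩ | ⟨h2, h3⟩ | ⟨h2, h3⟩ | ⟨h2, h3⟩ | ⟨h2, h3⟩ | ⟨h2, h3⟩
  · exact exists_distinct_of_card_le (by omega) h2 h3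
  · obtain ⟨i, hi, k, hk, j, hj, h1, h2, h3⟩ :=
      exists_distinct_of_card_le (A := A) (by omega) h2 h3
    exact ⟨i, hi, j, hj, k, hk, h2, h1, h3.symm⟩
  · obtain ⟨j, hj, i, hi, k, hk, h1, h2, h3⟩ :=
      exists_distinct_of_card_le (A := B) (by omega) h2 h3
    exact ⟨i, hi, j, hj, k, hk, h1.symm, h3, h2⟩
  · obtain ⟨j, hj, k, hk, i, hi, h1, h2, h3⟩ :=
      exists_distinct_of_card_le (A := B) (by omega) h2 h3
    exact ⟨i, hi, j, hj, k, hk, h2.symm, h3.symm, h1⟩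
  · obtain ⟨k, hk, i, hi, j, hj, h1, h2, h3⟩ :=
      exists_distinct_of_card_le (A := C) (by omega) h2 h3
    exact ⟨i, hi, j, hj, k, hk, h3, h1.symm, h2.symm⟩
  · obtain ⟨k, hk, j, hj, i, hi, h1, h2, h3⟩ :=
      exists_distinct_of_card_le (A := C) (by omega) h2 h3
    exact ⟨i, hi, j, hj, k, hk, h3.symm, h2.symm, h1.symm⟩

/-- The points of the tetrahedron whose link contains the pair `x, y`. -/
def linkColors (G : Finset (Finset V)) (k : Fin 4 ↪ V) (x y : V) : Finset (Fin 4) :=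
  univ.filter fun i => ({k i, x, y} : Finset V) ∈ G

lemma sum_edgeInd_eq_card_linkColors (k : Fin 4 ↪ V) (x y : V) :
    ∑ i, edgeInd G (k i) x y = (linkColors G k x y).card := by
  simp [edgeInd, linkColors]

lemma IsTetrahedron.card_linkColors_le_twenty {k : Fin 4 ↪ V} (hk : IsTetrahedron G k)
    (hF : ¬ Contains G fano) {x y z t : V} (hx : x ∉ Set.range k) (hy : y ∉ Set.range k)
    (hz : z ∉ Set.range k) (ht : t ∉ Set.range k) (hxy : x ≠ y) (hxz : x ≠ z) (hxt : x ≠ t)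
    (hyz : y ≠ z) (hyt : y ≠ t) (hzt : z ≠ t) :
    (linkColors G k x y).card + (linkColors G k z t).card +
      ((linkColors G k x z).card + (linkColors G k y t).card) +
      ((linkColors G k x t).card + (linkColors G k y z).card) ≤ 20 := by
  by_contra! hlt
  -- Two colour sets on the edges of a matching share at least the sum of their sizes minus 4
  -- colours. A total of at least 21 therefore leaves at least 21 - 12 = 9 common colours over the
  -- three matchings, enough to give each its own tetrahedron vertex.
  have hint : ∀ A B : Finset (Fin 4), A.card + B.card ≤ (A ∩ B).card + 4 := by
    intro A B
    have h1 := Finset.card_union_add_card_inter A B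
    have h2 := Finset.card_le_univ (A ∪ B)
    simp only [Fintype.card_fin] at h2
    omega
  have e1 := hint (linkColors G k x y) (linkColors G k z t)
  have e2 := hint (linkColors G k x z) (linkColors G k y t)
  have e3 := hint (linkColors G k x t) (linkColors G k y z)
  obtain ⟨a, ha, c, hc, b, hb, hac, hab, hcb⟩ := exists_distinct_representatives
    (A := linkColors G k x y ∩ linkColors G k z t) (B := linkColors G k x z ∩ linkColors G k y t)
    (C := linkColors G k x t ∩ linkColors G k y z) (by omega)
  simp only [linkColors, Finset.mem_inter, Finset.mem_filter, Finset.mem_univ, true_and]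
    at ha hb hc
  refine hF (contains_fano_of_matchings (i := k a) (j := k b) (k := k c) (x := x) (y := y)
    (z := z) (t := t) ?_ (hk a b c hab hac hcb.symm) ha.1 ha.2 hb.1 hb.2 hc.1 hc.2)
  have hr : ∀ {v}, v ∉ Set.range k → ∀ i, k i ≠ v := fun hv i h => hv ⟨i, h⟩
  simp only [List.nodup_cons, List.mem_cons, List.not_mem_nil, or_false, not_or, not_false_eq_true,
    List.nodup_nil, and_true, k.injective.eq_iff]
  refine ⟨⟨hab, hr ht a, hac, hr hx a, hr hy a, hr hz a⟩,
    ⟨hr ht b, hcb.symm, hr hx b, hr hy b, hr hz b⟩,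
    ⟨(hr ht c).symm, hxt.symm, hyt.symm, hzt.symm⟩, ⟨hr hx c, hr hy c, hr hz c⟩,
    ⟨hxy, hxz⟩, hyz⟩

/-- Some vertex of a tetrahedron in a Fano-free hypergraph has a link of density about `3/4`. -/
lemma IsTetrahedron.exists_link_le [Fintype V] {k : Fin 4 ↪ V} (hk : IsTetrahedron G k)
    (hG : IsUniform G) (hF : ¬ Contains G fano) :
    ∃ v, ∑ x, ∑ y, edgeInd G v x y ≤
      3 / 4 * (Fintype.card V : ℝ) ^ 2 + 8 * (Fintype.card V : ℝ) := by
  set n : ℝ := (Fintype.card V : ℝ)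
  set w : V → V → ℝ := fun x y => ∑ i, edgeInd G (k i) x y with hw
  have hsymm : ∀ x y, w x y = w y x := fun x y =>
    Finset.sum_congr rfl fun i _ => edgeInd_comm_right _ _ _
  have hle : ∀ x y, w x y ≤ 4 := by
    intro x y
    have := Finset.sum_le_sum fun i (_ : i ∈ (univ : Finset (Fin 4))) =>
      edgeInd_le_one (G := G) (k i) x y
    simpa using this
  set T : Finset V := univ.map k
  have hTc : T.card = 4 := by simp [T]
  -- The tetrahedron is left out because the seven points of a Fano plane must be distinct; the
  -- pairs meeting it contribute only O(n).
  have hmain : ∑ x ∈ univ \ T, ∑ y ∈ univ \ T, w x y ≤ 3 * ((univ \ T).card : ℝ) ^ 2 := by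
    refine sum_weight_le_of_four_le_twenty hsymm
      (fun x => Finset.sum_eq_zero fun i _ => hG.edgeInd_right_self x (k i)) hle
      (fun x y => ⟨(linkColors G k x y).card, by
        simpa using sum_edgeInd_eq_card_linkColors (G := G) k x y⟩) _ ?_
    intro x hx y hy z hz t ht h1 h2 h3 h4 h5 h6
    have hr : ∀ {v}, v ∈ univ \ T → v ∉ Set.range k := by
      intro v hv
      simpa [T] using hv
    simp only [hw, sum_edgeInd_eq_card_linkColors]
    exact_mod_cast hk.card_linkColors_le_twenty hF (hr hx) (hr hy) (hr hz) (hr ht) h1 h2 h3 h4 h5 h6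
  have hcard : ((univ \ T).card : ℝ) + 4 = n := by
    have := Finset.card_sdiff_add_card_eq_card (Finset.subset_univ T)
    rw [hTc, Finset.card_univ] at this
    simp only [n]
    exact_mod_cast this
  have hcross : ∑ x ∈ univ \ T, ∑ y ∈ T, w x y ≤ ((univ \ T).card : ℝ) * 16 := by
    rw [← nsmul_eq_mul]
    refine Finset.sum_le_card_nsmul _ _ _ fun x _ => ?_
    have := Finset.sum_le_card_nsmul T (fun y => w x y) 4 fun y _ => hle x y
    rw [hTc] at this
    refine this.trans (by norm_num)
  have hin : ∑ x ∈ T, ∑ y ∈ T, w x y ≤ 64 := by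
    have := Finset.sum_le_card_nsmul T (fun x => ∑ y ∈ T, w x y) 16 fun x _ => by
      have := Finset.sum_le_card_nsmul T (fun y => w x y) 4 fun y _ => hle x y
      rw [hTc] at this
      refine this.trans (by norm_num)
    rw [hTc] at this
    refine this.trans (by norm_num)
  have htot : ∑ i, ∑ x, ∑ y, edgeInd G (k i) x y ≤ 3 * n ^ 2 + 32 * n := by
    have e : ∑ i, ∑ x, ∑ y, edgeInd G (k i) x y = ∑ x, ∑ y, w x y := by
      rw [Finset.sum_comm]
      exact Finset.sum_congr rfl fun x _ => Finset.sum_comm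
    rw [e, sum_sum_sdiff_union hsymm (Finset.subset_univ T)]
    have h0 : (0 : ℝ) ≤ (univ \ T).card := Nat.cast_nonneg _
    rw [← hcard]
    nlinarith
  by_contra! hcon
  have := Finset.sum_lt_sum_of_nonempty (Finset.univ_nonempty (α := Fin 4))
    fun i _ => hcon (k i)
  simp only [Finset.sum_const, Finset.card_univ, Fintype.card_fin, nsmul_eq_mul] at this
  push_cast at this
  linarith

/-- A hypergraph of large codegree squared sum contains a tetrahedron. -/
lemma IsUniform.sum_sq_pairDeg_le_of_no_tetrahedron [Fintype V] (hG : IsUniform G)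
    (hK : ∀ k : Fin 4 ↪ V, ¬ IsTetrahedron G k) :
    ∑ x, ∑ y, pairDeg G x y ^ 2 ≤ 2 / 3 * (Fintype.card V : ℝ) ^ 4 := by
  set n : ℝ := (Fintype.card V : ℝ)
  -- When xyz is an edge, not all three other triples can be edges, degenerate quadruples included.
  -- Summing over ordered quadruples turns each of the three products into ∑ d².
  have hpt : ∀ x y z t, edgeInd G x y z * (edgeInd G x y t + edgeInd G x z t + edgeInd G y z t) ≤
      2 := by
    intro x y z t
    by_contra! hcon
    have h0 : ({x, y, z} : Finset V) ∈ G := by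
      by_contra h
      simp only [edgeInd, h, if_false, zero_mul] at hcon
      linarith
    have hb := edgeInd_le_one (G := G)
    have hz : edgeInd G x y z = 1 := if_pos h0
    rw [hz, one_mul] at hcon
    have hmem : ∀ a b c, 0 < edgeInd G a b c → ({a, b, c} : Finset V) ∈ G := by
      intro a b c h
      by_contra h'
      simp [edgeInd, h'] at h
    have h1 := hmem x y t (by linarith [hb x z t, hb y z t])
    have h2 := hmem x z t (by linarith [hb x y t, hb y z t])
    have h3 := hmem y z t (by linarith [hb x z t, hb x y t])
    have d0 := hG.distinct h0
    have d1 := hG.distinct h1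
    have d2 := hG.distinct h2
    have hnd : [x, y, z, t].Nodup := by
      simp [d0, d1.2, d2.2]
    refine hK ⟨[x, y, z, t].get, List.nodup_iff_injective_get.1 hnd⟩ ?_
    intro i j l hij hil hjl
    have hcases : ∀ i j l : Fin 4, i ≠ j → i ≠ l → j ≠ l →
        ({i, j, l} : Finset (Fin 4)) = {0, 1, 2} ∨ ({i, j, l} : Finset (Fin 4)) = {0, 1, 3} ∨
        ({i, j, l} : Finset (Fin 4)) = {0, 2, 3} ∨ ({i, j, l} : Finset (Fin 4)) = {1, 2, 3} := by
      decide
    have himg : ∀ a b c : Fin 4, ({[x, y, z, t].get a, [x, y, z, t].get b, [x, y, z, t].get c} :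
        Finset V) = ({a, b, c} : Finset (Fin 4)).image [x, y, z, t].get := by
      intro a b c
      simp [Finset.image_insert]
    change ({[x, y, z, t].get i, [x, y, z, t].get j, [x, y, z, t].get l} : Finset V) ∈ G
    rw [himg]
    rcases hcases i j l hij hil hjl with h | h | h | h <;> rw [h, ← himg]
    exacts [h0, h1, h2, h3]
  have hsum : ∑ x, ∑ y, ∑ z, ∑ t,
      edgeInd G x y z * (edgeInd G x y t + edgeInd G x z t + edgeInd G y z t) ≤ 2 * n ^ 4 := by
    calc _ ≤ ∑ x : V, ∑ y : V, ∑ z : V, ∑ t : V, (2 : ℝ) :=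
          Finset.sum_le_sum fun x _ => Finset.sum_le_sum fun y _ => Finset.sum_le_sum fun z _ =>
            Finset.sum_le_sum fun t _ => hpt x y z t
      _ = 2 * n ^ 4 := by simp [n]; ring
  have e1 : ∑ x, ∑ y, ∑ z, edgeInd G x y z * pairDeg G x y = ∑ x, ∑ y, pairDeg G x y ^ 2 := by
    refine Finset.sum_congr rfl fun x _ => Finset.sum_congr rfl fun y _ => ?_
    rw [← Finset.sum_mul, sq]; rfl
  have e2 : ∑ x, ∑ y, ∑ z, edgeInd G x y z * pairDeg G x z = ∑ x, ∑ y, pairDeg G x y ^ 2 := by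
    rw [← e1]
    refine Finset.sum_congr rfl fun x _ => ?_
    rw [Finset.sum_comm]
    exact Finset.sum_congr rfl fun y _ => Finset.sum_congr rfl fun z _ => by
      rw [edgeInd_comm_right]
  have e3 : ∑ x, ∑ y, ∑ z, edgeInd G x y z * pairDeg G y z = ∑ x, ∑ y, pairDeg G x y ^ 2 := by
    rw [← e2, Finset.sum_comm]
    exact Finset.sum_congr rfl fun x _ => Finset.sum_congr rfl fun y _ =>
      Finset.sum_congr rfl fun z _ => by rw [edgeInd_comm_left]
  have e4 : ∑ x, ∑ y, ∑ z, ∑ t,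
      edgeInd G x y z * (edgeInd G x y t + edgeInd G x z t + edgeInd G y z t) =
      3 * ∑ x, ∑ y, pairDeg G x y ^ 2 := by
    simp only [← Finset.mul_sum, Finset.sum_add_distrib, mul_add]
    change ∑ x, ∑ y, ∑ z, edgeInd G x y z * pairDeg G x y +
      ∑ x, ∑ y, ∑ z, edgeInd G x y z * pairDeg G x z +
      ∑ x, ∑ y, ∑ z, edgeInd G x y z * pairDeg G y z = _
    rw [e1, e2, e3]; ring
  linarith

end Tetrahedron

/-! ### Vertex deletion and averaging. -/

section Deletion

variable {V W : Type*} [DecidableEq V]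

/-- The hypergraph induced on `W` by an embedding `W ↪ V`. -/
def comap [Fintype W] (f : W ↪ V) (G : Finset (Finset V)) : Finset (Finset W) :=
  (univ.powersetCard 3).filter fun e => e.map f ∈ G

lemma isUniform_comap [Fintype W] (f : W ↪ V) (G : Finset (Finset V)) :
    IsUniform (comap f G) := fun _ he =>
  (Finset.mem_powersetCard.1 (Finset.mem_filter.1 he).1).2

lemma Contains.of_comap [Fintype W] {U : Type*} {H : Finset (Finset U)} {f : W ↪ V}
    {G : Finset (Finset V)} (h : Contains (comap f G) H) : Contains G H := by
  obtain ⟨g, hg⟩ := h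
  refine ⟨g.trans f, fun e he => ?_⟩
  rw [← Finset.map_map]
  exact (Finset.mem_filter.1 (hg e he)).2

lemma IsUniform.edgeInd_comap [Fintype W] [DecidableEq W] {G : Finset (Finset V)} (hG : IsUniform G) (f : W ↪ V)
    (x y z : W) : edgeInd (comap f G) x y z = edgeInd G (f x) (f y) (f z) := by
  have h : ({x, y, z} : Finset W).map f = {f x, f y, f z} := by simp [Finset.map_insert]
  unfold edgeInd comap
  congr 1
  simp only [Finset.mem_filter, Finset.mem_powersetCard, Finset.subset_univ, true_and, h, eq_iff_iff,
    and_iff_right_iff_imp]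
  intro hm
  rw [← Finset.card_map f, h]
  exact hG _ hm

lemma mem_freeHypergraphs {n : ℕ} {U : Type*} {H : Finset (Finset U)}
    {G : Finset (Finset (Fin n))} :
    G ∈ freeHypergraphs 3 n H ↔ IsUniform G ∧ ¬ Contains G H := by
  classical
  unfold freeHypergraphs IsUniform
  rw [Finset.mem_filter, Finset.mem_powerset]
  refine and_congr_left fun _ => ⟨fun h e he => (Finset.mem_powersetCard.1 (h he)).2, fun h e he => ?_⟩
  exact Finset.mem_powersetCard.2 ⟨Finset.subset_univ _, h e he⟩

/-- Deleting the vertex `v` from a hypergraph on `n + 1` vertices. -/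
lemma two_mul_co2_deletion {n : ℕ} {G : Finset (Finset (Fin (n + 1)))} (hG : IsUniform G)
    (v : Fin (n + 1)) :
    2 * (co2 3 (comap v.succAboveEmb G) : ℝ) =
      ∑ x, ∑ y, (pairDeg G (v.succAbove x) (v.succAbove y) -
        edgeInd G (v.succAbove x) (v.succAbove y) v) ^ 2 := by
  rw [(isUniform_comap _ _).two_mul_co2]
  refine Finset.sum_congr rfl fun x _ => Finset.sum_congr rfl fun y _ => ?_
  congr 1
  simp only [pairDeg, hG.edgeInd_comap]
  rw [Fin.sum_univ_succAbove _ v]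
  simp

lemma co2_deletion_le_exco2 {n : ℕ} {U : Type*} {H : Finset (Finset U)}
    {G : Finset (Finset (Fin (n + 1)))} (hF : ¬ Contains G H) (v : Fin (n + 1)) :
    co2 3 (comap v.succAboveEmb G) ≤ exco2 3 n H :=
  Finset.le_sup (f := co2 3) (mem_freeHypergraphs.2
    ⟨isUniform_comap _ _, fun h => hF h.of_comap⟩)

lemma exists_co2_eq_exco2 {n : ℕ} {U : Type*} {H : Finset (Finset U)} (hH : H.Nonempty) :
    ∃ G : Finset (Finset (Fin n)), IsUniform G ∧ ¬ Contains G H ∧ co2 3 G = exco2 3 n H := by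
  have hne : (freeHypergraphs 3 n H).Nonempty := by
    refine ⟨∅, mem_freeHypergraphs.2 ⟨by simp [IsUniform], ?_⟩⟩
    rintro ⟨f, hf⟩
    obtain ⟨e, he⟩ := hH
    simpa using hf e he
  obtain ⟨G, hG, h⟩ := Finset.exists_mem_eq_sup _ hne (co2 3)
  exact ⟨G, (mem_freeHypergraphs.1 hG).1, (mem_freeHypergraphs.1 hG).2, h.symm⟩

lemma sum_sum_succAbove {n : ℕ} (v : Fin (n + 1)) (f : Fin (n + 1) → Fin (n + 1) → ℝ)
    (hf : ∀ x, f x v = f v x) (hv : f v v = 0) :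
    ∑ x, ∑ y, f x y = (∑ x, ∑ y, f (v.succAbove x) (v.succAbove y)) + 2 * ∑ y, f v y := by
  rw [Fin.sum_univ_succAbove _ v]
  have h : ∀ x, ∑ y, f (v.succAbove x) y =
      f v (v.succAbove x) + ∑ y, f (v.succAbove x) (v.succAbove y) := fun x => by
    rw [Fin.sum_univ_succAbove _ v, hf]
  simp_rw [h, Finset.sum_add_distrib]
  rw [Fin.sum_univ_succAbove (fun y => f v y) v, hv]
  ring

/-- Averaging over vertex deletions. -/
lemma sum_co2_deletion {n : ℕ} {G : Finset (Finset (Fin (n + 1)))} (hG : IsUniform G) :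
    ∑ v : Fin (n + 1), 2 * (co2 3 (comap v.succAboveEmb G) : ℝ) =
      ∑ x, ∑ y, (((n : ℝ) - 3) * pairDeg G x y ^ 2 + pairDeg G x y) := by
  -- The full sum also counts the pairs (v, y) and (y, v), where the indicator vanishes; hence the
  -- correction by twice the row of v.
  have h1 : ∀ v, 2 * (co2 3 (comap v.succAboveEmb G) : ℝ) =
      ∑ x, ∑ y, (pairDeg G x y - edgeInd G x y v) ^ 2 - 2 * ∑ y, pairDeg G v y ^ 2 := by
    intro v
    rw [two_mul_co2_deletion hG, sum_sum_succAbove v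
      (fun x y => (pairDeg G x y - edgeInd G x y v) ^ 2)]
    · simp [hG.edgeInd_outer_self]
    · intro x
      rw [pairDeg_comm, edgeInd_comm_left]
    · simp [hG.pairDeg_self, hG.edgeInd_left_self]
  simp_rw [h1]
  rw [Finset.sum_sub_distrib, ← Finset.mul_sum, Finset.sum_comm, Finset.mul_sum,
    ← Finset.sum_sub_distrib]
  refine Finset.sum_congr rfl fun x _ => ?_
  rw [Finset.sum_comm, Finset.mul_sum, ← Finset.sum_sub_distrib]
  refine Finset.sum_congr rfl fun y _ => ?_
  have h2 : ∀ v, (pairDeg G x y - edgeInd G x y v) ^ 2 =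
      pairDeg G x y ^ 2 - 2 * pairDeg G x y * edgeInd G x y v + edgeInd G x y v := by
    intro v
    nth_rw 3 [← edgeInd_sq]
    ring
  simp_rw [h2]
  rw [Finset.sum_add_distrib, Finset.sum_sub_distrib, ← Finset.mul_sum]
  change _ - 2 * pairDeg G x y * pairDeg G x y + pairDeg G x y - _ = _
  simp
  ring

/-- Since d ≤ n - 1, also d ≥ d²/(n - 1), so the averaged summand (n - 3)d² + d is at least (n -
2)²/(n - 1) · d². This factor matches the ratio of consecutive normalizations exactly. -/
lemma exco2_succ_mul_le {n : ℕ} {U : Type*} {H : Finset (Finset U)} (hH : H.Nonempty)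
    (hn : 2 ≤ n) :
    ((n : ℝ) - 2) ^ 2 * exco2 3 (n + 1) H ≤ ((n : ℝ) - 1) * ((n + 1) * exco2 3 n H) := by
  obtain ⟨G, hG, hF, hco⟩ := exists_co2_eq_exco2 (n := n + 1) hH
  have hn' : (2 : ℝ) ≤ n := by exact_mod_cast hn
  have h1 : ∑ v : Fin (n + 1), 2 * (co2 3 (comap v.succAboveEmb G) : ℝ) ≤ (n + 1) * (2 * exco2 3 n H) := by
    have := Finset.sum_le_card_nsmul univ
      (fun v : Fin (n + 1) => 2 * (co2 3 (comap v.succAboveEmb G) : ℝ)) (2 * exco2 3 n H)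
      fun v _ => by
        have := co2_deletion_le_exco2 hF v
        have : (co2 3 (comap v.succAboveEmb G) : ℝ) ≤ exco2 3 n H := by exact_mod_cast this
        linarith
    simpa using this
  have h2 : ((n : ℝ) - 2) ^ 2 * ∑ x, ∑ y, pairDeg G x y ^ 2 ≤ ((n : ℝ) - 1) *
      ∑ x, ∑ y, (((n : ℝ) - 3) * pairDeg G x y ^ 2 + pairDeg G x y) := by
    simp only [Finset.mul_sum]
    refine Finset.sum_le_sum fun x _ => Finset.sum_le_sum fun y _ => ?_
    by_cases hxy : x = y
    · subst hxy; simp [hG.pairDeg_self]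
    · have hle := hG.pairDeg_le_sub hxy
      have h0 := pairDeg_nonneg (G := G) x y
      simp only [Fintype.card_fin] at hle
      push_cast at hle
      nlinarith [mul_nonneg h0 (sub_nonneg.2 hle)]
  rw [← hG.two_mul_co2, ← sum_co2_deletion hG, hco] at h2
  have := mul_le_mul_of_nonneg_left h1 (show (0 : ℝ) ≤ n - 1 by linarith)
  linarith

end Deletion

/-! ### Existence of the limit. -/

lemma fano_nonempty : fano.Nonempty := ⟨{0, 1, 3}, by simp [fano]⟩

lemma scaledExco2_three {U : Type*} (H : Finset (Finset U)) (n : ℕ) :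
    scaledExco2 3 H n = exco2 3 n H / ((n : ℝ) * (n - 1) / 2 * ((n : ℝ) - 2) ^ 2) := by
  unfold scaledExco2
  rw [show 3 - 1 = 2 from rfl, Nat.cast_choose_two]
  congr 3
  push_cast; ring

lemma scaledExco2_nonneg {U : Type*} (k : ℕ) (H : Finset (Finset U)) (n : ℕ) :
    0 ≤ scaledExco2 k H n := by
  unfold scaledExco2; positivity

/-- The start at 3 matters: for n ≤ 2 the denominator is 0, so the quotient takes the default value
0. -/
lemma scaledExco2_succ_le {U : Type*} {H : Finset (Finset U)} (hH : H.Nonempty) {n : ℕ}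
    (hn : 3 ≤ n) : scaledExco2 3 H (n + 1) ≤ scaledExco2 3 H n := by
  have h := exco2_succ_mul_le hH (show 2 ≤ n by omega)
  have hn' : (3 : ℝ) ≤ n := by exact_mod_cast hn
  rw [scaledExco2_three, scaledExco2_three]
  push_cast
  have e1 : (0 : ℝ) < n - 2 := by linarith
  have e2 : (0 : ℝ) < n - 1 := by linarith
  have e3 : (0 : ℝ) < n := by linarith
  rw [div_le_div_iff₀ (by
    have : (n : ℝ) + 1 - 2 = n - 1 := by ring
    rw [this, add_sub_cancel_right]; positivity) (by positivity)]
  have := mul_le_mul_of_nonneg_left h (show (0 : ℝ) ≤ n * (n - 1) / 2 by positivity)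
  nlinarith

/-- `sigma` is a `limUnder`, meaningful only once convergence is known; monotonicity and the lower
bound 0 supply it. -/
lemma tendsto_scaledExco2 {U : Type*} {H : Finset (Finset U)} (hH : H.Nonempty) :
    Filter.Tendsto (scaledExco2 3 H) Filter.atTop (nhds (sigma 3 H)) := by
  have hanti : Antitone fun n => scaledExco2 3 H (n + 3) :=
    antitone_nat_of_succ_le fun n => scaledExco2_succ_le hH (n := n + 3) (by omega)
  have hb : BddBelow (Set.range fun n => scaledExco2 3 H (n + 3)) :=
    ⟨0, by rintro _ ⟨n, rfl⟩; exact scaledExco2_nonneg _ _ _⟩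
  have := tendsto_atTop_ciInf hanti hb
  exact tendsto_nhds_limUnder ⟨_, (Filter.tendsto_add_atTop_iff_nat 3).1 this⟩

/-! ### The upper bound 11/16. -/

section UpperBound

/-- Deleting a vertex `v` whose link has `P / 2` edges loses little of the codegree squared sum. -/
lemma co2_le_deletion_add {n : ℕ} {G : Finset (Finset (Fin (n + 1)))} (hG : IsUniform G)
    (v : Fin (n + 1)) :
    (co2 3 G : ℝ) ≤ co2 3 (comap v.succAboveEmb G) +
      (∑ x, ∑ y, edgeInd G v x y) ^ 2 / (2 * (n + 1)) +
      (n + 1) * (∑ x, ∑ y, edgeInd G v x y) + co2 3 G / (n + 1) := by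
  set N : ℝ := (n : ℝ) + 1 with hN
  have hN0 : 0 < N := by positivity
  set P : ℝ := ∑ x, ∑ y, edgeInd G v x y with hP
  -- The degree of x in the link of v is the codegree of {v, x}, so de Caen's bound controls the
  -- lost pairs through v.
  have hq := sum_sq_degree_le (A := edgeInd G v) (fun x y => edgeInd_comm_right v x y)
    (edgeInd_nonneg v) (edgeInd_le_one v)
  simp only [Fintype.card_fin, Nat.cast_add, Nat.cast_one, ← hN, ← hP] at hq
  change 2 * N * ∑ x, pairDeg G v x ^ 2 ≤ _ at hq
  have hq' : ∑ x, pairDeg G v x ^ 2 ≤ P ^ 2 / (2 * N) + N * P / 2 := by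
    have : P ^ 2 / (2 * N) + N * P / 2 = (P ^ 2 + N ^ 2 * P) / (2 * N) := by
      field_simp
    rw [this, le_div_iff₀ (by positivity)]
    linarith
  have hpt : ∀ x y, pairDeg G x y ^ 2 ≤ (pairDeg G x y - edgeInd G x y v) ^ 2 +
      (N * edgeInd G v x y + pairDeg G x y ^ 2 / N) := by
    intro x y
    have e0 : edgeInd G v x y = edgeInd G x y v := edgeInd_rotate _ _ _
    rw [e0]
    -- AM-GM with weight N. The resulting term co₂(G)/N is kept, to be absorbed later on the left
    -- side.
    have e1 : 2 * pairDeg G x y * edgeInd G x y v ≤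
        N * edgeInd G x y v + pairDeg G x y ^ 2 / N := by
      have h1 : 0 ≤ (pairDeg G x y - N * edgeInd G x y v) ^ 2 / N := by positivity
      have h2 : (pairDeg G x y - N * edgeInd G x y v) ^ 2 / N = pairDeg G x y ^ 2 / N -
          2 * pairDeg G x y * edgeInd G x y v + N * edgeInd G x y v ^ 2 := by
        field_simp
        ring
      rw [h2, edgeInd_sq] at h1
      linarith
    nlinarith [sq_nonneg (edgeInd G x y v)]
  have hdel := two_mul_co2_deletion hG v
  have htot := hG.two_mul_co2
  have hsplit := sum_sum_succAbove v (fun x y => pairDeg G x y ^ 2)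
    (fun x => by rw [pairDeg_comm]) (by simp [hG.pairDeg_self])
  have hle : ∑ x, ∑ y, pairDeg G (v.succAbove x) (v.succAbove y) ^ 2 ≤
      2 * (co2 3 (comap v.succAboveEmb G) : ℝ) + (N * P + 2 * co2 3 G / N) := by
    have h1 : ∑ x, ∑ y, (N * edgeInd G v x y + pairDeg G x y ^ 2 / N) =
        N * P + 2 * co2 3 G / N := by
      rw [htot, hP]
      simp only [Finset.sum_add_distrib, Finset.mul_sum, Finset.sum_div]
    have h2 : ∑ x, ∑ y, (N * edgeInd G v (v.succAbove x) (v.succAbove y) +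
        pairDeg G (v.succAbove x) (v.succAbove y) ^ 2 / N) ≤ N * P + 2 * co2 3 G / N := by
      rw [← h1]
      have hnn : ∀ x y, 0 ≤ N * edgeInd G v x y + pairDeg G x y ^ 2 / N := by
        intro x y
        have := edgeInd_nonneg (G := G) v x y
        positivity
      rw [Fin.sum_univ_succAbove (fun x => ∑ y, (N * edgeInd G v x y + pairDeg G x y ^ 2 / N)) v]
      refine le_add_of_nonneg_of_le (Finset.sum_nonneg fun y _ => hnn _ _)
        (Finset.sum_le_sum fun x _ => ?_)
      rw [Fin.sum_univ_succAbove _ v]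
      exact le_add_of_nonneg_left (hnn _ _)
    rw [hdel]
    refine le_trans ?_ (add_le_add_right h2 _)
    rw [← Finset.sum_add_distrib]
    refine Finset.sum_le_sum fun x _ => ?_
    rw [← Finset.sum_add_distrib]
    exact Finset.sum_le_sum fun y _ => hpt _ _
  rw [← htot] at hsplit
  have e : 2 * (co2 3 G : ℝ) / N = 2 * (co2 3 G / N) := by ring
  linarith

lemma co2_le {n : ℕ} {G : Finset (Finset (Fin n))} (hG : IsUniform G) :
    (co2 3 G : ℝ) ≤ (n : ℝ) ^ 4 / 2 := by
  have h : ∑ x, ∑ y, pairDeg G x y ^ 2 ≤ ∑ x : Fin n, ∑ y : Fin n, (n : ℝ) ^ 2 := by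
    refine Finset.sum_le_sum fun x _ => Finset.sum_le_sum fun y _ => ?_
    have := pairDeg_le (G := G) x y
    simp only [Fintype.card_fin] at this
    exact pow_le_pow_left₀ (pairDeg_nonneg _ _) this 2
  rw [← hG.two_mul_co2] at h
  simp at h
  nlinarith

/-- With P ≈ 3/4 N² the deletion loses about (9/32 + 3/4) N³ + co₂/N. For co₂ = cN⁴ the induction
balances when 4c = 33/32 + c, that is c = 11/32. -/
lemma exco2_fano_le (n : ℕ) :
    (exco2 3 n fano : ℝ) ≤ 11 / 32 * (n : ℝ) ^ 4 + 30 * (n : ℝ) ^ 3 := by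
  induction n with
  | zero =>
    obtain ⟨G, hG, -, hco⟩ := exists_co2_eq_exco2 (n := 0) fano_nonempty
    rw [← hco]
    simpa using co2_le hG
  | succ n ih =>
    obtain ⟨G, hG, hF, hco⟩ := exists_co2_eq_exco2 (n := n + 1) fano_nonempty
    rw [← hco]
    set N : ℝ := (n : ℝ) + 1 with hN
    have hnN : (n : ℝ) = N - 1 := by rw [hN]; ring
    push_cast
    rw [← hN]
    -- For small N the cubic term covers the trivial bound N⁴/2.
    by_cases hsmall : n + 1 < 100
    · have h := co2_le hG
      push_cast at h
      rw [← hN] at h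
      have h100 : N ≤ 100 := by rw [hN]; exact_mod_cast hsmall.le
      have h3 : 0 ≤ N ^ 3 := by positivity
      nlinarith
    have h100 : 100 ≤ N := by rw [hN]; exact_mod_cast not_lt.1 hsmall
    by_cases hK : ∃ k : Fin 4 ↪ Fin (n + 1), IsTetrahedron G k
    · obtain ⟨k, hk⟩ := hK
      obtain ⟨v, hv⟩ := hk.exists_link_le hG hF
      have hloss := co2_le_deletion_add hG v
      have hdel : (co2 3 (comap v.succAboveEmb G) : ℝ) ≤ exco2 3 n fano := by
        exact_mod_cast co2_deletion_le_exco2 hF v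
      simp only [Fintype.card_fin, Nat.cast_add, Nat.cast_one] at hv
      rw [← hN] at hv hloss
      rw [hnN] at ih
      set P : ℝ := ∑ x, ∑ y, edgeInd G v x y
      set X : ℝ := (co2 3 G : ℝ)
      have hP0 : 0 ≤ P := Finset.sum_nonneg fun x _ => Finset.sum_nonneg fun y _ =>
        edgeInd_nonneg _ _ _
      have hN0 : 0 < N := by linarith
      have hP2 : P ^ 2 / (2 * N) ≤ 9 / 32 * N ^ 3 + 6 * N ^ 2 + 32 * N := by
        rw [div_le_iff₀ (by positivity)]
        calc P ^ 2 ≤ (3 / 4 * N ^ 2 + 8 * N) ^ 2 := pow_le_pow_left₀ hP0 hv 2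
          _ = _ := by ring
      have hNP : N * P ≤ 3 / 4 * N ^ 3 + 8 * N ^ 2 := by nlinarith
      have hX : X ≤ 11 / 32 * (N - 1) ^ 4 + 30 * (N - 1) ^ 3 +
          (33 / 32 * N ^ 3 + 14 * N ^ 2 + 32 * N) + X / N := by linarith
      by_contra! hcon
      have hXN : X - X / N = X * ((N - 1) / N) := by field_simp
      have hlow : (11 / 32 * N ^ 4 + 30 * N ^ 3) * ((N - 1) / N) ≤ X * ((N - 1) / N) :=
        mul_le_mul_of_nonneg_right hcon.le (div_nonneg (by linarith) hN0.le)
      have hlow' : (11 / 32 * N ^ 4 + 30 * N ^ 3) * ((N - 1) / N) =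
          (11 / 32 * N ^ 3 + 30 * N ^ 2) * (N - 1) := by field_simp
      rw [hlow', ← hXN] at hlow
      -- The N⁴ and N³ coefficients agree on both sides; the contradiction comes from the N² terms,
      -- where 30 is ample.
      nlinarith
    · push Not at hK
      have h := hG.sum_sq_pairDeg_le_of_no_tetrahedron hK
      rw [← hG.two_mul_co2] at h
      simp only [Fintype.card_fin, Nat.cast_add, Nat.cast_one] at h
      rw [← hN] at h
      have h3 : 0 ≤ N ^ 3 := by positivity
      have h4 : 0 ≤ N ^ 4 := by positivity
      -- Here co₂ ≤ N⁴/3, and 1/3 < 11/32.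
      linarith

lemma sigma_fano_le : sigma 3 fano ≤ 11 / 16 := by
  have hlim : Filter.Tendsto (fun n : ℕ => (11 / 16 + 60 * (n : ℝ)⁻¹) /
      ((1 - (n : ℝ)⁻¹) * (1 - 2 * (n : ℝ)⁻¹) ^ 2)) Filter.atTop (nhds (11 / 16)) := by
    have h0 : Filter.Tendsto (fun n : ℕ => (n : ℝ)⁻¹) Filter.atTop (nhds 0) :=
      tendsto_inv_atTop_nhds_zero_nat
    have h1 : Filter.Tendsto (fun n : ℕ => (11 / 16 + 60 * (n : ℝ)⁻¹) /
        ((1 - (n : ℝ)⁻¹) * (1 - 2 * (n : ℝ)⁻¹) ^ 2)) Filter.atTop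
        (nhds ((11 / 16 + 60 * 0) / ((1 - 0) * (1 - 2 * 0) ^ 2))) :=
      ((h0.const_mul 60).const_add _).div
        ((h0.const_sub 1).mul (((h0.const_mul 2).const_sub 1).pow 2)) (by norm_num)
    simpa using h1
  refine le_of_tendsto_of_tendsto (tendsto_scaledExco2 fano_nonempty) hlim ?_
  filter_upwards [Filter.eventually_ge_atTop 3] with n hn
  have hn' : (3 : ℝ) ≤ n := by exact_mod_cast hn
  have e0 : (0 : ℝ) < n := by linarith
  have e1 : (0 : ℝ) < n - 1 := by linarith
  have e2 : (0 : ℝ) < n - 2 := by linarith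
  have heq : (11 / 16 + 60 * (n : ℝ)⁻¹) / ((1 - (n : ℝ)⁻¹) * (1 - 2 * (n : ℝ)⁻¹) ^ 2) =
      (11 / 32 * (n : ℝ) ^ 4 + 30 * (n : ℝ) ^ 3) / ((n : ℝ) * (n - 1) / 2 * ((n : ℝ) - 2) ^ 2) := by
    field_simp
    ring
  rw [heq, scaledExco2_three]
  exact div_le_div_of_nonneg_right (exco2_fano_le n) (by positivity)

end UpperBound

end CodegreeSquared

theorem mainTheorem9 :
    Filter.Tendsto (CodegreeSquared.scaledExco2 3 CodegreeSquared.fano) Filter.atTop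
        (nhds (CodegreeSquared.sigma 3 CodegreeSquared.fano)) ∧
      CodegreeSquared.sigma 3 CodegreeSquared.fano ≤ 11 / 16 :=
  ⟨CodegreeSquared.tendsto_scaledExco2 CodegreeSquared.fano_nonempty,
    CodegreeSquared.sigma_fano_le⟩
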